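/- For a probability measure $\mu$ on $\mathbb{R}^n$, let $\Lambda_\mu(\lambda)=\log\int e^{\langle\lambda,x\rangle}\,d\mu(x)\in\mathbb{R}\cup\{+\infty\}$, $\lambda\in\mathbb{R}^n$, be its logarithmic Laplace transform, $\mathcal{D}_{\Lambda_\mu}=\{\Lambda_\mu<+\infty\}$ its domain, and $\Lambda_\mu^*(x)=\sup_{\lambda\in\mathbb{R}^n}\{\langle\lambda,x\rangle-\Lambda_\mu(\lambda)\}$, $x\in\mathbb{R}^n$, its Legendre transform. Say that $\Lambda_\mu$ is essentially smooth if $\mathrm{int}(\mathcal{D}_{\Lambda_\mu})$ is non-empty, $\Lambda_\mu$ is differentiable on $\mathrm{int}(\mathcal{D}_{\Lambda_\mu})$, and $\|\nabla\Lambda_\mu(\lambda_k)\|\to+\infty$ for every sequence $(\lambda_k)$ in $\mathrm{int}(\mathcal{D}_{\Lambda_\mu})$ converging to a point of the boundary of $\mathcal{D}_{\Lambda_\mu}$. Let $X$ be a random vector in $\mathbb{R}^n$ with law $\mu$, such that the support of $\mu$ is not included in an (affine) hyperplane and $\Lambda_\mu$ is essentially smooth. Let $f:\mathbb{R}^n\to\mathbb{R}$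 be measurable, and define $$I(t)=\inf\{\Lambda_\mu^*(y): y\in\mathbb{R}^n,\ f(y)=t\}\in[0,+\infty],\qquad t\in\mathbb{R},$$ with $\inf\emptyset=+\infty$. Let $r>0$, and assume that $\kappa\ge r$ is such that $K=\{x\in\mathbb{R}^n:\Lambda_\mu^*(x)\le\kappa\}$ satisfies $$\mathbb{P}(X\notin K)\le e^{-r}.$$ Let $W\subset\mathbb{R}^n$ be a compact convex set such that $$f(x)-f(y)\le\sup_{\lambda\in W}\langle\lambda,x-y\rangle\qquad\text{for all }x,y\in K.$$ Let $D\in[0,+\infty]$ be the diameter of $K$, let $L=\sup_{\lambda\in W}\|\lambda\|_{\ell^2}$, let $\delta>0$, and let $\mathcal{D}_{\delta/2}$ be a $\frac{\delta}{2D}$-net of $W$ for the $\ell^2$-norm, that is, a finite subset of $\mathbb{R}^n$ such that every point of $W$ is at $\ell^2$-distance at most $\frac{\delta}{2D}$ from some point of $\mathcal{D}_{\delta/2}$. Then $$\log\mathbb{P}\big(f(X)\notin V_\delta(\{I\le r\})\big)\le -r+\log|\mathcal{D}_{\delta/2}|+\log\Big(\Big(\frac{\kappa LD}{\delta}\Big)\vee1\Big)+2,$$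 where $V_\delta(A)=\{x\in\mathbb{R}:\inf_{y\in A}|x-y|<\delta\}$ is the open $\delta$-neighbourhood of $A\subset\mathbb{R}$. Here $\log 0=-\infty$, $\log(+\infty)=+\infty$, $\delta/0=+\infty$, $\delta/(+\infty)=0$ and $0\cdot(+\infty)=0$. -/

import Mathlib

open MeasureTheory ProbabilityTheory Filter Topology
open scoped ENNReal

noncomputable section

/-- The logarithmic Laplace transform `Λ_μ(l) = log ∫ exp ⟨l, x⟩ dμ(x)`, with values in
`[-∞, +∞]`. -/
def logLaplace {n : ℕ} (μ : Measure (EuclideanSpace ℝ (Fin n)))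
    (l : EuclideanSpace ℝ (Fin n)) : EReal :=
  ENNReal.log (∫⁻ x, ENNReal.ofReal (Real.exp (inner ℝ l x)) ∂μ)

/-- The Legendre transform `F*(x) = sup_l {⟨l, x⟩ - F(l)}` of an extended real function. -/
def legendreTransform {n : ℕ} (F : EuclideanSpace ℝ (Fin n) → EReal)
    (x : EuclideanSpace ℝ (Fin n)) : EReal :=
  ⨆ l : EuclideanSpace ℝ (Fin n), ((inner ℝ l x : ℝ) : EReal) - F l

/-- The effective domain `{F < +∞}`. -/
def effDomain {n : ℕ} (F : EuclideanSpace ℝ (Fin n) → EReal) :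
    Set (EuclideanSpace ℝ (Fin n)) :=
  {l | F l < ⊤}

/-- Essential smoothness of a convex function `F` with values in `ℝ ∪ {+∞}`: the interior of the
domain is non-empty, `F` is differentiable there, and `F` is steep at the boundary. -/
structure IsEssentiallySmooth {n : ℕ} (F : EuclideanSpace ℝ (Fin n) → EReal) : Prop where
  interior_nonempty : (interior (effDomain F)).Nonempty
  differentiableAt : ∀ l ∈ interior (effDomain F),
    DifferentiableAt ℝ (fun m => (F m).toReal) l
  steep : ∀ u : ℕ → EuclideanSpace ℝ (Fin n), (∀ k, u k ∈ interior (effDomain F)) →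
    ∀ l ∈ frontier (effDomain F), Tendsto u atTop (𝓝 l) →
      Tendsto (fun k => ‖gradient (fun m => (F m).toReal) (u k)‖) atTop atTop

/-- The support of `μ` is not included in an (affine) hyperplane. -/
def NotInHyperplane {n : ℕ} (μ : Measure (EuclideanSpace ℝ (Fin n))) : Prop :=
  ∀ v : EuclideanSpace ℝ (Fin n), v ≠ 0 → ∀ c : ℝ, ¬ μ.support ⊆ {x | inner ℝ v x = c}

/-- The function `I(t) = inf {Λ_μ*(y) : f(y) = t}`, equal to `+∞` when `t` is not a value
of `f`. -/
def rateFn {n : ℕ} (μ : Measure (EuclideanSpace ℝ (Fin n)))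
    (f : EuclideanSpace ℝ (Fin n) → ℝ) (t : ℝ) : EReal :=
  ⨅ (y : EuclideanSpace ℝ (Fin n)) (_ : f y = t), legendreTransform (logLaplace μ) y

/-- The support function `h_W(z) = sup_{l ∈ W} ⟨l, z⟩`, equal to `-∞` when `W` is empty. -/
def supportFn {n : ℕ} (W : Set (EuclideanSpace ℝ (Fin n)))
    (z : EuclideanSpace ℝ (Fin n)) : EReal :=
  ⨆ l ∈ W, ((inner ℝ l z : ℝ) : EReal)

/-- `N` is a finite `ε`-net of `W` for the Euclidean norm: each point of `W` is within distance
`ε` of some point of `N`. The points of `N` need not lie in `W`. -/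
def IsNet {n : ℕ} (ε : ℝ≥0∞) (W : Set (EuclideanSpace ℝ (Fin n)))
    (N : Finset (EuclideanSpace ℝ (Fin n))) : Prop :=
  ∀ l ∈ W, ∃ m ∈ N, edist l m ≤ ε

end

/-!
Write `Z = {Λ* ≤ r}`, a convex subset of `K`. Two applications of the minimax principle
(`exists_forall_lt_of_forall_exists_lt`) carry the proof.

The first one gives a non-asymptotic large deviation bound: a closed convex set `C` on which
`Λ* > r` satisfies `μ C ≤ exp (-r)` (`measure_le_exp_neg_of_isClosed_of_convex`). When `C` is
compact, minimax exchanges the point of `C` and the functional that witnesses `Λ* > r`, so that a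
single exponential Chernoff bound works for all of `C`; the general case follows by exhaustion.

The second one linearizes `f`. If `x ∈ K` and `f x` is at distance at least `δ` from `{I ≤ r}`, then
`f x` differs from every value of `f` on `Z` by at least `δ`, always with the same sign since `f` is
continuous on the connected set `Z`. Hence `h_W (x - y) ≥ δ` for all `y ∈ Z` (or `h_W (y - x) ≥ δ`
for all `y ∈ Z`), and minimax yields one `l ∈ W` with `⟪l, x - y⟫ ≥ δ` for all `y ∈ Z` (or the same
with `-l`). Replacing `l` by a point `m` of the net costs at most `δ / 2`. Therefore `x` belongs to
one of the `2 |N|` closed convex sets `separationSet (±m) Z (δ / 2)`, which are disjoint from `Z`,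
and each has measure at most `exp (-r)`. Adding `P (X ∉ K) ≤ exp (-r)` gives
`(1 + 2 |N|) exp (-r) ≤ |N| exp (2 - r)`, since `|N| ≥ 1` and `3 ≤ exp 2`.

Since the bound holds already without the term `log ((κ L D / δ) ∨ 1) ≥ 0`, the infinite values of
`D` need no separate treatment.
-/

/-! ### A minimax principle for affine functionals -/

/-- Minimax for a compact convex set `C` of points and a convex set `Y` of affine functionals,
where `(l, c)` encodes `x ↦ ⟪l, x⟫ - c`. -/
theorem exists_forall_lt_of_forall_exists_lt {E : Type*} [NormedAddCommGroup E]
    [InnerProductSpace ℝ E] {C : Set E} (hCne : C.Nonempty) (hC : IsCompact C)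
    (hCconv : Convex ℝ C) {Y : Set (E × ℝ)} (hY : Convex ℝ Y)
    (h : ∀ x ∈ C, ∃ p ∈ Y, p.2 < inner ℝ p.1 x) :
    ∃ p ∈ Y, ∀ x ∈ C, p.2 < inner ℝ p.1 x := by
  have hcover : ∀ x ∈ C, ∃ p : Y, x ∈ {x : E | (p : E × ℝ).2 < inner ℝ (p : E × ℝ).1 x} := by
    intro x hx
    obtain ⟨p, hp, hlt⟩ := h x hx
    exact ⟨⟨p, hp⟩, hlt⟩
  obtain ⟨t, ht⟩ := hC.elim_finite_subcover
    (fun p : Y => {x : E | (p : E × ℝ).2 < inner ℝ (p : E × ℝ).1 x})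
    (fun p => isOpen_lt (by fun_prop) (by fun_prop))
    (fun x hx => Set.mem_iUnion.2 (hcover x hx))
  have hfin := Sion.exists_lt_iInf_of_lt_iInf_of_finite (X := C) (Y := Y)
    (f := fun (x : E) (p : E × ℝ) => (inner ℝ p.1 x : ℝ) - p.2) hCne hC
    (fun p _ => (Continuous.lowerSemicontinuous (by fun_prop)).lowerSemicontinuousOn _)
    (fun p _ => by
      have hlin : ConvexOn ℝ C fun x => innerₗ E p.1 x + -p.2 :=
        ConvexOn.add_const (LinearMap.convexOn _ hCconv) _
      exact hlin.quasiconvexOn) hY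
    (fun x _ => (Continuous.upperSemicontinuous (by fun_prop)).upperSemicontinuousOn _)
    (fun x _ => by
      have hlin : ConcaveOn ℝ Y
          ⇑((innerₗ E x).comp (LinearMap.fst ℝ E ℝ) - LinearMap.snd ℝ E ℝ) :=
        LinearMap.concaveOn _ hY
      refine (hlin.congr ?_).quasiconcaveOn
      intro p _
      simp [real_inner_comm])
    hCconv (s := Subtype.val '' (t : Set Y)) (t.finite_toSet.image _)
    (by rintro _ ⟨p, _, rfl⟩; exact p.2) (t := 0)
    (by
      intro x hx
      obtain ⟨p, hp, hlt⟩ := Set.mem_iUnion₂.1 (ht hx)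
      exact ⟨p, ⟨p, hp, rfl⟩, sub_pos.2 hlt⟩)
  obtain ⟨p, hp, hpC⟩ := hfin
  exact ⟨p, hp, fun x hx => sub_pos.1 (hpC x hx)⟩

/-! ### Convexity and the Chernoff bound -/

theorem convex_setOf_legendreTransform_le {n : ℕ} (F : EuclideanSpace ℝ (Fin n) → EReal) (r : ℝ) :
    Convex ℝ {x | legendreTransform F x ≤ (r : EReal)} := by
  intro x hx y hy a b ha hb hab
  simp only [Set.mem_ofPred_eq, legendreTransform, iSup_le_iff] at hx hy ⊢
  intro l
  specialize hx l
  specialize hy l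
  induction h : F l using EReal.rec with
  | bot => simp [h] at hx
  | top => simp
  | coe c =>
    rw [h] at hx hy
    norm_cast at hx hy ⊢
    rw [inner_add_right, inner_smul_right, inner_smul_right]
    have hcomb := add_le_add (mul_le_mul_of_nonneg_left hx ha) (mul_le_mul_of_nonneg_left hy hb)
    have h₁ : (a + b) * c = c := by rw [hab, one_mul]
    have h₂ : (a + b) * r = r := by rw [hab, one_mul]
    linarith

/-- The affine functionals `x ↦ ⟪l, x⟫ - c` whose exponential moment is at most `M` form a convex
set, because `exp` is convex. -/
theorem convex_setOf_lintegral_exp_le {n : ℕ} (μ : Measure (EuclideanSpace ℝ (Fin n)))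
    (M : ℝ≥0∞) :
    Convex ℝ {p : EuclideanSpace ℝ (Fin n) × ℝ |
      ∫⁻ x, ENNReal.ofReal (Real.exp (inner ℝ p.1 x - p.2)) ∂μ ≤ M} := by
  intro p hp q hq a b ha hb hab
  simp only [Set.mem_ofPred_eq] at hp hq ⊢
  calc ∫⁻ x, ENNReal.ofReal (Real.exp (inner ℝ (a • p + b • q).1 x - (a • p + b • q).2)) ∂μ
      ≤ ∫⁻ x, (ENNReal.ofReal a * ENNReal.ofReal (Real.exp (inner ℝ p.1 x - p.2)) +
          ENNReal.ofReal b * ENNReal.ofReal (Real.exp (inner ℝ q.1 x - q.2))) ∂μ := by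
        refine lintegral_mono fun x => ?_
        rw [← ENNReal.ofReal_mul ha, ← ENNReal.ofReal_mul hb,
          ← ENNReal.ofReal_add (by positivity) (by positivity)]
        refine ENNReal.ofReal_le_ofReal ?_
        have hexp := convexOn_exp.2 (Set.mem_univ (inner ℝ p.1 x - p.2))
          (Set.mem_univ (inner ℝ q.1 x - q.2)) ha hb hab
        simp only [smul_eq_mul] at hexp
        refine le_trans (le_of_eq ?_) hexp
        simp only [Prod.fst_add, Prod.smul_fst, Prod.snd_add, Prod.smul_snd, inner_add_left,
          real_inner_smul_left, smul_eq_mul]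
        ring_nf
    _ = ENNReal.ofReal a * ∫⁻ x, ENNReal.ofReal (Real.exp (inner ℝ p.1 x - p.2)) ∂μ +
          ENNReal.ofReal b * ∫⁻ x, ENNReal.ofReal (Real.exp (inner ℝ q.1 x - q.2)) ∂μ := by
        rw [lintegral_add_left (by fun_prop), lintegral_const_mul _ (by fun_prop),
          lintegral_const_mul _ (by fun_prop)]
    _ ≤ ENNReal.ofReal a * M + ENNReal.ofReal b * M := by gcongr
    _ = M := by
        rw [← add_mul, ← ENNReal.ofReal_add ha hb, hab, ENNReal.ofReal_one, one_mul]

/-- If `Λ*(x) > r`, some affine functional is positive at `x` and has exponential moment at most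
`exp (-r)`. -/
theorem exists_affine_of_lt_legendreTransform {n : ℕ} {μ : Measure (EuclideanSpace ℝ (Fin n))}
    {r : ℝ} {x : EuclideanSpace ℝ (Fin n)}
    (hx : (r : EReal) < legendreTransform (logLaplace μ) x) :
    ∃ p : EuclideanSpace ℝ (Fin n) × ℝ,
      ∫⁻ z, ENNReal.ofReal (Real.exp (inner ℝ p.1 z - p.2)) ∂μ ≤ ENNReal.ofReal (Real.exp (-r)) ∧
        p.2 < inner ℝ p.1 x := by
  obtain ⟨l, hl⟩ := lt_iSup_iff.1 hx
  obtain ⟨c, hcl, hcx⟩ : ∃ c : ℝ, logLaplace μ l ≤ c ∧ c + r < inner ℝ l x := by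
    induction h : logLaplace μ l using EReal.rec with
    | bot => exact ⟨inner ℝ l x - r - 1, bot_le, by linarith⟩
    | top => simp [h] at hl
    | coe c =>
      rw [h] at hl
      norm_cast at hl
      exact ⟨c, le_rfl, by linarith⟩
  have hmom : ∫⁻ z, ENNReal.ofReal (Real.exp (inner ℝ l z)) ∂μ ≤ ENNReal.ofReal (Real.exp c) := by
    rw [← ENNReal.log_le_log_iff, ← EReal.exp_coe, EReal.log_exp]
    exact hcl
  refine ⟨(l, c + r), ?_, hcx⟩
  calc ∫⁻ z, ENNReal.ofReal (Real.exp (inner ℝ l z - (c + r))) ∂μ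
      = ∫⁻ z, ENNReal.ofReal (Real.exp (inner ℝ l z)) *
          ENNReal.ofReal (Real.exp (-(c + r))) ∂μ := by
        refine lintegral_congr fun z => ?_
        rw [← ENNReal.ofReal_mul (Real.exp_nonneg _), ← Real.exp_add, sub_eq_add_neg]
    _ = (∫⁻ z, ENNReal.ofReal (Real.exp (inner ℝ l z)) ∂μ) *
          ENNReal.ofReal (Real.exp (-(c + r))) := lintegral_mul_const _ (by fun_prop)
    _ ≤ ENNReal.ofReal (Real.exp c) * ENNReal.ofReal (Real.exp (-(c + r))) := by gcongr
    _ = ENNReal.ofReal (Real.exp (-r)) := by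
        rw [← ENNReal.ofReal_mul (Real.exp_nonneg _), ← Real.exp_add]
        ring_nf

theorem measure_le_exp_neg_of_isCompact_of_convex {n : ℕ}
    {μ : Measure (EuclideanSpace ℝ (Fin n))} {r : ℝ} {C : Set (EuclideanSpace ℝ (Fin n))}
    (hC : IsCompact C) (hCconv : Convex ℝ C)
    (h : ∀ x ∈ C, (r : EReal) < legendreTransform (logLaplace μ) x) :
    μ C ≤ ENNReal.ofReal (Real.exp (-r)) := by
  rcases C.eq_empty_or_nonempty with rfl | hne
  · simp
  obtain ⟨p, hp, hpC⟩ := exists_forall_lt_of_forall_exists_lt hne hC hCconv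
    (convex_setOf_lintegral_exp_le μ (ENNReal.ofReal (Real.exp (-r))))
    (fun x hx => exists_affine_of_lt_legendreTransform (h x hx))
  calc μ C ≤ μ {x | 1 ≤ ENNReal.ofReal (Real.exp (inner ℝ p.1 x - p.2))} := by
        refine measure_mono fun x hx => ?_
        rw [Set.mem_ofPred_eq, ENNReal.one_le_ofReal, Real.one_le_exp_iff]
        exact (sub_pos.2 (hpC x hx)).le
    _ ≤ ∫⁻ x, ENNReal.ofReal (Real.exp (inner ℝ p.1 x - p.2)) ∂μ := by
        simpa using mul_meas_ge_le_lintegral (μ := μ)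
          (f := fun x => ENNReal.ofReal (Real.exp (inner ℝ p.1 x - p.2))) (by fun_prop) 1
    _ ≤ ENNReal.ofReal (Real.exp (-r)) := hp

/-- The large deviation upper bound for closed convex sets, valid without any error term. -/
theorem measure_le_exp_neg_of_isClosed_of_convex {n : ℕ}
    {μ : Measure (EuclideanSpace ℝ (Fin n))} {r : ℝ} {C : Set (EuclideanSpace ℝ (Fin n))}
    (hC : IsClosed C) (hCconv : Convex ℝ C)
    (h : ∀ x ∈ C, (r : EReal) < legendreTransform (logLaplace μ) x) :
    μ C ≤ ENNReal.ofReal (Real.exp (-r)) := by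
  have hmono : Monotone fun k : ℕ =>
      C ∩ Metric.closedBall (0 : EuclideanSpace ℝ (Fin n)) (k : ℝ) := fun i j hij =>
    Set.inter_subset_inter_right _ (Metric.closedBall_subset_closedBall (by exact_mod_cast hij))
  have hunion : ⋃ k : ℕ, C ∩ Metric.closedBall (0 : EuclideanSpace ℝ (Fin n)) (k : ℝ) = C := by
    rw [← Set.inter_iUnion, Metric.iUnion_closedBall_nat, Set.inter_univ]
  rw [← hunion, hmono.measure_iUnion]
  exact iSup_le fun k => measure_le_exp_neg_of_isCompact_of_convex
    ((isCompact_closedBall _ _).inter_left hC) (hCconv.inter (convex_closedBall _ _))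
    fun x hx => h x hx.1

/-! ### Support functions -/

theorem IsCompact.exists_supportFn_eq {n : ℕ} {W : Set (EuclideanSpace ℝ (Fin n))}
    (hW : IsCompact W) (hne : W.Nonempty) (z : EuclideanSpace ℝ (Fin n)) :
    ∃ l ∈ W, supportFn W z = ((inner ℝ l z : ℝ) : EReal) := by
  obtain ⟨l, hl, hmax⟩ := hW.exists_isMaxOn hne
    (f := fun l => (inner ℝ l z : ℝ)) (by fun_prop)
  refine ⟨l, hl, le_antisymm (iSup₂_le fun m hm => ?_) (le_iSup₂_of_le l hl le_rfl)⟩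
  exact_mod_cast hmax hm

/-- A lower bound for the support function of a compact convex set `W` on a convex set `S` is
attained by a single linear functional of `W`. -/
theorem exists_forall_le_inner_of_le_supportFn {n : ℕ} {W S : Set (EuclideanSpace ℝ (Fin n))}
    (hW : IsCompact W) (hWconv : Convex ℝ W) (hne : W.Nonempty) (hS : Convex ℝ S) {d : ℝ}
    (h : ∀ z ∈ S, (d : EReal) ≤ supportFn W z) :
    ∃ l ∈ W, ∀ z ∈ S, d ≤ inner ℝ l z := by
  by_contra! hcon
  obtain ⟨p, ⟨z, hz, rfl⟩, hpW⟩ := exists_forall_lt_of_forall_exists_lt hne hW hWconv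
    (Y := (fun z => (-z, -d)) '' S)
    (by
      rintro _ ⟨z, hz, rfl⟩ _ ⟨w, hw, rfl⟩ a b ha hb hab
      refine ⟨a • z + b • w, hS hz hw ha hb hab, Prod.ext ?_ ?_⟩
      · simp [add_comm]
      · simp only [Prod.snd_add, Prod.smul_snd, smul_eq_mul]
        linear_combination d * hab)
    (by
      intro l hl
      obtain ⟨z, hz, hlt⟩ := hcon l hl
      exact ⟨_, ⟨z, hz, rfl⟩, by simpa [real_inner_comm] using hlt⟩)
  obtain ⟨l, hl, hsup⟩ := hW.exists_supportFn_eq hne z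
  have hle := h z hz
  rw [hsup, EReal.coe_le_coe_iff] at hle
  have hlt := hpW l hl
  simp only [inner_neg_left, neg_lt_neg_iff] at hlt
  rw [real_inner_comm] at hlt
  linarith

theorem continuousOn_of_sub_le_supportFn {n : ℕ} {W K : Set (EuclideanSpace ℝ (Fin n))}
    {f : EuclideanSpace ℝ (Fin n) → ℝ} (hW : IsCompact W) (hne : W.Nonempty)
    (hf : ∀ x ∈ K, ∀ y ∈ K, ((f x - f y : ℝ) : EReal) ≤ supportFn W (x - y)) :
    ContinuousOn f K := by
  obtain ⟨R, hR⟩ := hW.isBounded.exists_norm_le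
  refine (LipschitzOnWith.of_le_add_mul' R fun x hx y hy => ?_).continuousOn
  obtain ⟨l, hl, hsup⟩ := hW.exists_supportFn_eq hne (x - y)
  have hle := hf x hx y hy
  rw [hsup, EReal.coe_le_coe_iff] at hle
  have hcs := real_inner_le_norm l (x - y)
  have hRl := mul_le_mul_of_nonneg_right (hR l hl) (norm_nonneg (x - y))
  rw [dist_eq_norm]
  linarith

/-! ### Separation of points from a set by the functionals of a net -/

/-- The points that the linear functional `u` separates from the set `Z` by a gap of at least
`d`. It is the whole space when `Z` is empty. -/
def separationSet {n : ℕ} (u : EuclideanSpace ℝ (Fin n)) (Z : Set (EuclideanSpace ℝ (Fin n)))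
    (d : ℝ) : Set (EuclideanSpace ℝ (Fin n)) :=
  {x | ∀ y ∈ Z, d ≤ inner ℝ u (x - y)}

theorem separationSet_eq_iInter {n : ℕ} (u : EuclideanSpace ℝ (Fin n))
    (Z : Set (EuclideanSpace ℝ (Fin n))) (d : ℝ) :
    separationSet u Z d = ⋂ y ∈ Z, {x | d + inner ℝ u y ≤ inner ℝ u x} := by
  ext x
  simp [separationSet, inner_sub_right, le_sub_iff_add_le]

theorem isClosed_separationSet {n : ℕ} (u : EuclideanSpace ℝ (Fin n))
    (Z : Set (EuclideanSpace ℝ (Fin n))) (d : ℝ) : IsClosed (separationSet u Z d) := by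
  rw [separationSet_eq_iInter]
  exact isClosed_biInter fun y _ => isClosed_le continuous_const (by fun_prop)

theorem convex_separationSet {n : ℕ} (u : EuclideanSpace ℝ (Fin n))
    (Z : Set (EuclideanSpace ℝ (Fin n))) (d : ℝ) : Convex ℝ (separationSet u Z d) := by
  rw [separationSet_eq_iInter]
  exact convex_iInter₂ fun y _ => convex_halfSpace_ge (innerₗ _ u).isLinear _

theorem measure_separationSet_le {n : ℕ} (μ : Measure (EuclideanSpace ℝ (Fin n))) (r : ℝ)
    (u : EuclideanSpace ℝ (Fin n)) {d : ℝ} (hd : 0 < d) :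
    μ (separationSet u {x | legendreTransform (logLaplace μ) x ≤ (r : EReal)} d) ≤
      ENNReal.ofReal (Real.exp (-r)) := by
  refine measure_le_exp_neg_of_isClosed_of_convex (isClosed_separationSet _ _ _)
    (convex_separationSet _ _ _) fun x hx => ?_
  by_contra! hle
  have hgap := hx x hle
  rw [sub_self, inner_zero_right] at hgap
  exact hgap.not_gt hd

/-- Moving a functional by at most `δ / (2 * diam K)` changes increments on `K` by at most
`δ / 2`. The conventions for division in `ℝ≥0∞` make this true also when the diameter is `0` or
`∞`. -/
theorem abs_inner_sub_le_of_edist_le {n : ℕ} {K : Set (EuclideanSpace ℝ (Fin n))}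
    {l m x y : EuclideanSpace ℝ (Fin n)} {δ : ℝ} (hδ : 0 < δ) (hx : x ∈ K) (hy : y ∈ K)
    (hlm : edist l m ≤ ENNReal.ofReal δ / (2 * Metric.ediam K)) :
    |inner ℝ (l - m) (x - y)| ≤ δ / 2 := by
  refine (abs_real_inner_le_norm _ _).trans ?_
  have hprod : edist l m * edist x y ≤ ENNReal.ofReal (δ / 2) := by
    calc edist l m * edist x y
        ≤ ENNReal.ofReal δ / (2 * Metric.ediam K) * Metric.ediam K :=
          mul_le_mul' hlm (Metric.edist_le_ediam_of_mem hx hy)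
      _ = ENNReal.ofReal δ / 2 / Metric.ediam K * Metric.ediam K := by
          rw [ENNReal.div_eq_inv_mul, ENNReal.mul_inv (by simp) (by simp)]
          simp only [ENNReal.div_eq_inv_mul]
          ring
      _ ≤ ENNReal.ofReal δ / 2 := ENNReal.mul_le_of_le_div le_rfl
      _ = ENNReal.ofReal (δ / 2) := by rw [ENNReal.ofReal_div_of_pos two_pos]; simp
  rw [edist_dist, edist_dist, ← ENNReal.ofReal_mul dist_nonneg,
    ENNReal.ofReal_le_ofReal_iff (by positivity), dist_eq_norm, dist_eq_norm] at hprod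
  exact hprod

/-- A continuous function on a convex set that stays at distance at least `δ` from a value `a` stays
on one side of it. -/
theorem forall_le_sub_or_forall_le_sub {n : ℕ} {Z : Set (EuclideanSpace ℝ (Fin n))}
    {f : EuclideanSpace ℝ (Fin n) → ℝ} (hZ : Convex ℝ Z) (hf : ContinuousOn f Z) {a δ : ℝ}
    (hδ : 0 < δ) (h : ∀ y ∈ Z, δ ≤ |a - f y|) :
    (∀ y ∈ Z, δ ≤ a - f y) ∨ ∀ y ∈ Z, δ ≤ f y - a := by
  by_contra! hcon
  obtain ⟨⟨y, hy, hya⟩, z, hz, hza⟩ := hcon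
  have hy' : a ≤ f y := by
    rcases le_abs.1 (h y hy) with h' | h' <;> linarith
  have hz' : f z ≤ a := by
    rcases le_abs.1 (h z hz) with h' | h' <;> linarith
  obtain ⟨w, hw, rfl⟩ := hZ.isPreconnected.intermediate_value hz hy hf ⟨hz', hy'⟩
  have hgap := h w hw
  rw [sub_self, abs_zero] at hgap
  exact hgap.not_gt hδ

/-- A point of `K` at which `f` differs by at least `δ` from all its values on `Z` is separated from
`Z` by a functional of the net, up to sign. -/
theorem exists_mem_separationSet_of_isNet {n : ℕ} {W K Z : Set (EuclideanSpace ℝ (Fin n))}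
    {f : EuclideanSpace ℝ (Fin n) → ℝ} {N : Finset (EuclideanSpace ℝ (Fin n))} {δ : ℝ}
    (hδ : 0 < δ) (hW : IsCompact W) (hWconv : Convex ℝ W) (hne : W.Nonempty)
    (hfW : ∀ x ∈ K, ∀ y ∈ K, ((f x - f y : ℝ) : EReal) ≤ supportFn W (x - y))
    (hN : IsNet (ENNReal.ofReal δ / (2 * Metric.ediam K)) W N) (hZ : Convex ℝ Z) (hZK : Z ⊆ K)
    {x : EuclideanSpace ℝ (Fin n)} (hx : x ∈ K) (h : ∀ y ∈ Z, δ ≤ |f x - f y|) :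
    ∃ m ∈ N, x ∈ separationSet m Z (δ / 2) ∪ separationSet (-m) Z (δ / 2) := by
  have hcont := (continuousOn_of_sub_le_supportFn hW hne hfW).mono hZK
  rcases forall_le_sub_or_forall_le_sub hZ hcont hδ h with hup | hdown
  · obtain ⟨l, hl, hlS⟩ := exists_forall_le_inner_of_le_supportFn hW hWconv hne
      (S := (fun y => x - y) '' Z) (d := δ)
      (by simpa [Set.singleton_sub] using (convex_singleton x).sub hZ)
      (by
        rintro _ ⟨y, hy, rfl⟩
        exact le_trans (by exact_mod_cast hup y hy) (hfW x hx y (hZK hy)))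
    obtain ⟨m, hm, hlm⟩ := hN l hl
    refine ⟨m, hm, Or.inl fun y hy => ?_⟩
    have h₁ : δ ≤ inner ℝ l (x - y) := hlS _ ⟨y, hy, rfl⟩
    have h₂ := le_of_abs_le (abs_inner_sub_le_of_edist_le hδ hx (hZK hy) hlm)
    rw [inner_sub_left] at h₂
    linarith
  · obtain ⟨l, hl, hlS⟩ := exists_forall_le_inner_of_le_supportFn hW hWconv hne
      (S := (fun y => y - x) '' Z) (d := δ)
      (by simpa [Set.sub_singleton] using hZ.sub (convex_singleton x))
      (by
        rintro _ ⟨y, hy, rfl⟩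
        exact le_trans (by exact_mod_cast hdown y hy) (hfW y (hZK hy) x hx))
    obtain ⟨m, hm, hlm⟩ := hN l hl
    refine ⟨m, hm, Or.inr fun y hy => ?_⟩
    have h₁ : δ ≤ inner ℝ l (y - x) := hlS _ ⟨y, hy, rfl⟩
    have h₂ := le_of_abs_le (abs_inner_sub_le_of_edist_le hδ (hZK hy) hx hlm)
    rw [inner_sub_left] at h₂
    rw [← neg_sub y x, inner_neg_neg]
    linarith

/-! ### The deviation inequality -/

theorem log_le_of_le_card_mul_exp {p M : ℝ≥0∞} {r : ℝ} {k : ℕ} (hk : 0 < k) (hM : 1 ≤ M)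
    (hp : p ≤ ENNReal.ofReal (Real.exp (-r)) + k * (2 * ENNReal.ofReal (Real.exp (-r)))) :
    ENNReal.log p ≤ ((-r : ℝ) : EReal) + ENNReal.log (k : ℝ≥0∞) + ENNReal.log M + 2 := by
  have hk' : (1 : ℝ≥0∞) ≤ k := by exact_mod_cast hk
  have h3 : (3 : ℝ≥0∞) ≤ ENNReal.ofReal (Real.exp 2) := by
    rw [← ENNReal.ofReal_ofNat 3]
    refine ENNReal.ofReal_le_ofReal ?_
    have := Real.add_one_le_exp (2 : ℝ)
    linarith
  have hbound : p ≤ ENNReal.ofReal (Real.exp (-r)) * k * M * ENNReal.ofReal (Real.exp 2) := by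
    calc p ≤ ENNReal.ofReal (Real.exp (-r)) + k * (2 * ENNReal.ofReal (Real.exp (-r))) := hp
      _ ≤ k * ENNReal.ofReal (Real.exp (-r)) + k * (2 * ENNReal.ofReal (Real.exp (-r))) := by
          gcongr
          exact le_mul_of_one_le_left' hk'
      _ = ENNReal.ofReal (Real.exp (-r)) * k * 1 * 3 := by ring
      _ ≤ ENNReal.ofReal (Real.exp (-r)) * k * M * ENNReal.ofReal (Real.exp 2) := by gcongr
  refine (ENNReal.log_monotone hbound).trans (le_of_eq ?_)
  rw [ENNReal.log_mul_add, ENNReal.log_mul_add, ENNReal.log_mul_add, ← EReal.exp_coe,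
    ← EReal.exp_coe, EReal.log_exp, EReal.log_exp]
  rfl

theorem mainTheorem1 {n : ℕ} {Ω : Type*} [MeasurableSpace Ω] (P : Measure Ω)
    [IsProbabilityMeasure P]
    (μ : Measure (EuclideanSpace ℝ (Fin n))) (X : Ω → EuclideanSpace ℝ (Fin n))
    (hX : HasLaw X μ P)
    (hsupp : NotInHyperplane μ) (hsmooth : IsEssentiallySmooth (logLaplace μ))
    (f : EuclideanSpace ℝ (Fin n) → ℝ) (hf : Measurable f)
    (r κ δ : ℝ) (hr : 0 < r) (hκ : r ≤ κ) (hδ : 0 < δ)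
    (K : Set (EuclideanSpace ℝ (Fin n)))
    (hK : K = {x | legendreTransform (logLaplace μ) x ≤ (κ : EReal)})
    (htight : P {ω | X ω ∉ K} ≤ ENNReal.ofReal (Real.exp (-r)))
    (W : Set (EuclideanSpace ℝ (Fin n))) (hWcompact : IsCompact W) (hWconvex : Convex ℝ W)
    (hfW : ∀ x ∈ K, ∀ y ∈ K, ((f x - f y : ℝ) : EReal) ≤ supportFn W (x - y))
    (D : ℝ≥0∞) (hD : D = Metric.ediam K)
    (L : ℝ≥0∞) (hL : L = ⨆ l ∈ W, ‖l‖ₑ)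
    (N : Finset (EuclideanSpace ℝ (Fin n))) (hN : IsNet (ENNReal.ofReal δ / (2 * D)) W N) :
    ENNReal.log (P {ω | f (X ω) ∉ Metric.thickening δ {t : ℝ | rateFn μ f t ≤ (r : EReal)}}) ≤
      ((-r : ℝ) : EReal) + ENNReal.log (N.card : ℝ≥0∞) +
        ENNReal.log (max (ENNReal.ofReal κ * L * D / ENNReal.ofReal δ) 1) + 2 := by
  subst hD
  set Z : Set (EuclideanSpace ℝ (Fin n)) :=
    {x | legendreTransform (logLaplace μ) x ≤ (r : EReal)}
  have hZK : Z ⊆ K := fun x hx => hK ▸ le_trans hx (EReal.coe_le_coe_iff.2 hκ)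
  -- `K` is charged by the law of `X`, and an empty `W` would force `K` to be empty.
  have hKne : K.Nonempty := by
    by_contra hempty
    rw [Set.not_nonempty_iff_eq_empty] at hempty
    simp only [hempty, Set.mem_empty_iff_false, not_false_eq_true, Set.ofPred_true, measure_univ,
      ENNReal.one_le_ofReal, Real.one_le_exp_iff] at htight
    linarith
  have hWne : W.Nonempty := by
    obtain ⟨x, hx⟩ := hKne
    by_contra hempty
    rw [Set.not_nonempty_iff_eq_empty] at hempty
    have hbot := hfW x hx x hx
    simp [hempty, supportFn] at hbot
  have hNpos : 0 < N.card := by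
    obtain ⟨l, hl⟩ := hWne
    obtain ⟨m, hm, -⟩ := hN l hl
    exact Finset.card_pos.2 ⟨m, hm⟩
  have hcover : {ω | f (X ω) ∉ Metric.thickening δ {t : ℝ | rateFn μ f t ≤ (r : EReal)}} ⊆
      {ω | X ω ∉ K} ∪ ⋃ m ∈ N, {ω | X ω ∈ separationSet m Z (δ / 2) ∪
        separationSet (-m) Z (δ / 2)} := by
    intro ω hω
    by_cases hXK : X ω ∈ K
    · have hgap : ∀ y ∈ Z, δ ≤ |f (X ω) - f y| := by
        intro y hy
        by_contra! hlt
        have hIy : rateFn μ f (f y) ≤ r := iInf₂_le_of_le y rfl hy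
        exact hω (Metric.mem_thickening_iff.2 ⟨f y, hIy, hlt⟩)
      obtain ⟨m, hm, hmem⟩ := exists_mem_separationSet_of_isNet hδ hWcompact hWconvex hWne hfW hN
        (convex_setOf_legendreTransform_le _ r) hZK hXK hgap
      exact Or.inr (Set.mem_iUnion₂.2 ⟨m, hm, hmem⟩)
    · exact Or.inl hXK
  have hpiece : ∀ m ∈ N, P {ω | X ω ∈ separationSet m Z (δ / 2) ∪ separationSet (-m) Z (δ / 2)} ≤
      2 * ENNReal.ofReal (Real.exp (-r)) := by
    intro m _
    rw [hX.measure_eq (p := fun x => x ∈ separationSet m Z (δ / 2) ∪ separationSet (-m) Z (δ / 2))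
      ((isClosed_separationSet m Z _).union (isClosed_separationSet (-m) Z _)).measurableSet,
      two_mul]
    exact (measure_union_le _ _).trans (add_le_add
      (measure_separationSet_le μ r m (half_pos hδ))
      (measure_separationSet_le μ r (-m) (half_pos hδ)))
  refine log_le_of_le_card_mul_exp hNpos (le_max_right _ _) ?_
  calc P {ω | f (X ω) ∉ Metric.thickening δ {t : ℝ | rateFn μ f t ≤ (r : EReal)}}
      ≤ P {ω | X ω ∉ K} + P (⋃ m ∈ N, {ω | X ω ∈ separationSet m Z (δ / 2) ∪
          separationSet (-m) Z (δ / 2)}) := (measure_mono hcover).trans (measure_union_le _ _)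
    _ ≤ ENNReal.ofReal (Real.exp (-r)) +
          ∑ m ∈ N, P {ω | X ω ∈ separationSet m Z (δ / 2) ∪ separationSet (-m) Z (δ / 2)} :=
        add_le_add htight (measure_biUnion_finset_le _ _)
    _ ≤ ENNReal.ofReal (Real.exp (-r)) +
          N.card * (2 * ENNReal.ofReal (Real.exp (-r))) := by
        gcongr
        simpa using Finset.sum_le_card_nsmul N _ _ hpiece
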